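/- Let $(A,B)$ be a pair of real random variables with $A\ge 0$ almost surely and $E|B/A|<\infty$, and let $(A_1,B_1),(A_2,B_2),\dots$ be independent copies of $(A,B)$. Put $\theta=E[B/A]$ and $E_n[f(A,B)]=n^{-1}\sum_{i=1}^n f(A_i,B_i)$. Let $m(a)=E[B\mid A=a]$, $a\ge 0$, be (a version of) the conditional expectation function, let $k\ge 1$ be an integer, and let $m^{(\kappa)}(0)$ denote the $\kappa$-th (right) derivative of $m$ at $0$. Let $h=h_n>0$ be deterministic trimming thresholds. For every $n$ and $1\le\kappa\le k-1$ let $\widehat m^{(\kappa)}(0)$ be an estimator (a random variable that may depend on $n$) of $m^{(\kappa)}(0)$, and let $\psi_\kappa=\psi_{n,\kappa}(A,B)$ be its influence function, a measurable function of $(A,B)$ that may depend on $n$. Assume the following. 1. (i) $m(0)=0$; (ii) $m$ is $k$ times continuously differentiable with bounded $k$-th derivative on $[0,\delta)$ for some $\delta>0$; (iii) $P(A=0)=0$; (iv) $E[B^4]<\infty$. 2. As $n\to\infty$: (i) $h\to 0$; (ii) $n h^{2(k-1)}=O(1)$; (iii) $n^{-1}h^{-4}\to 0$. 3. For each $\kappa\in\{1,\dots,k-1\}$: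 (i) $h^{\kappa-1}\bigl(\widehat m^{(\kappa)}(0)-m^{(\kappa)}(0)\bigr)=h^{\kappa-1}E_n[\psi_\kappa]+o_p(n^{-1/2})$; (ii) $E[\psi_\kappa]=0$ for every $n$; (iii) $E\bigl[(h^{\kappa-1}\psi_\kappa)^4\bigr]^{1/4}=O(n^{1/4})$. Define the trimmed estimator, the bias estimator and $Z_h$ by $$\widehat\theta_h=E_n\Bigl[\tfrac{B}{A}\mathbf 1\{A\ge h\}\Bigr],\qquad \widehat B_h=-\sum_{\kappa=1}^{k-1}\frac{E_n[A^{\kappa-1}\mathbf 1\{A<h\}]}{\kappa!}\,\widehat m^{(\kappa)}(0),$$ $$Z_h=\tfrac{B}{A}\mathbf 1\{A\ge h\}+\sum_{\kappa=1}^{k-1}\frac{E[A^{\kappa-1}\mathbf 1\{A<h\}]}{\kappa!}\,\psi_\kappa .$$ If $\operatorname{Var}(Z_h)$ is bounded away from zero (that is, for some $c>0$, $\operatorname{Var}(Z_h)\ge c$ for all large $n$), then, as $n\to\infty$, $$\frac{\widehat\theta_h-\widehat B_h-\theta}{\sqrt{\operatorname{Var}(Z_h)/n}}\ \xrightarrow{d}\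 N(0,1).$$ -/

import Mathlib

open MeasureTheory ProbabilityTheory Filter Topology Asymptotics

namespace TrimmedRatio

noncomputable section

/-! A point `p : ℝ × ℝ` is a realization `(a, b)` of `(A, B)`, and `Q` is the joint law of `(A, B)`,
so that `E[f(A, B)] = ∫ p, f p ∂Q`. -/

/-- The function `(a, b) ↦ (b / a) · 1{a ≥ h}`. -/
def trimmedRatio (h : ℝ) : ℝ × ℝ → ℝ :=
  Set.indicator {p | h ≤ p.1} (fun p => p.2 / p.1)

/-- The function `(a, b) ↦ a ^ (κ - 1) · 1{a < h}` (used for `κ ≥ 1` only). -/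
def trimmedPower (h : ℝ) (κ : ℕ) : ℝ × ℝ → ℝ :=
  Set.indicator {p | p.1 < h} (fun p => p.1 ^ (κ - 1))

/-- The parameter of interest `θ = E[B / A]`. -/
def theta (Q : Measure (ℝ × ℝ)) : ℝ := ∫ p, p.2 / p.1 ∂Q

/-- The component `E[A ^ (κ - 1) · 1{A < h}] / κ!` of the vector `c_h`. -/
def coeff (Q : Measure (ℝ × ℝ)) (h : ℝ) (κ : ℕ) : ℝ :=
  (∫ p, trimmedPower h κ p ∂Q) / (κ.factorial : ℝ)

/-- `Z_h = (B / A) · 1{A ≥ h} + c_h' ψ`, as a function of `(A, B)`, where `ψ κ`, `1 ≤ κ ≤ k - 1`,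
are the components of the influence function. -/
def Z (Q : Measure (ℝ × ℝ)) (k : ℕ) (h : ℝ) (ψ : ℕ → ℝ × ℝ → ℝ) (p : ℝ × ℝ) : ℝ :=
  trimmedRatio h p + ∑ κ ∈ Finset.Icc 1 (k - 1), coeff Q h κ * ψ κ p

/-- The empirical mean `E_n[f(A, B)]` over the first `n` observations `X 0, …, X (n - 1)`. -/
def empMean {Ω : Type*} (X : ℕ → Ω → ℝ × ℝ) (n : ℕ) (f : ℝ × ℝ → ℝ) (ω : Ω) : ℝ :=
  (n : ℝ)⁻¹ * ∑ i ∈ Finset.range n, f (X i ω)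

/-- The trimmed estimator `E_n[(B / A) · 1{A ≥ h}]`. -/
def trimmedEstimator {Ω : Type*} (X : ℕ → Ω → ℝ × ℝ) (n : ℕ) (h : ℝ) (ω : Ω) : ℝ :=
  empMean X n (trimmedRatio h) ω

/-- The bias estimator `- ∑_{κ = 1}^{k - 1} (E_n[A ^ (κ - 1) · 1{A < h}] / κ!) · m̂^{(κ)}(0)`, where
`mhat κ` is the estimator of `m^{(κ)}(0)`. -/
def biasEstimator {Ω : Type*} (X : ℕ → Ω → ℝ × ℝ) (n k : ℕ) (h : ℝ) (mhat : ℕ → Ω → ℝ)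
    (ω : Ω) : ℝ :=
  - ∑ κ ∈ Finset.Icc 1 (k - 1),
      empMean X n (trimmedPower h κ) ω / (κ.factorial : ℝ) * mhat κ ω

/-- `m` is a version of the conditional expectation function `a ↦ E[B | A = a]`. -/
def IsCondMean (Q : Measure (ℝ × ℝ)) (m : ℝ → ℝ) : Prop :=
  Measurable m ∧
    Q[(fun p : ℝ × ℝ => p.2) | MeasurableSpace.comap (fun p : ℝ × ℝ => p.1) inferInstance]
      =ᵐ[Q] fun p => m p.1

/-- The derivative `m^{(κ)}(a)` for `a ≥ 0`. As `A` takes values in `[0, ∞)`, the function `m` is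
considered on `[0, ∞)`, so that derivatives at `0` are right derivatives; they are the ordinary ones
when `m` is smooth on both sides of `0`. -/
def derivOnNonneg (m : ℝ → ℝ) (κ : ℕ) (a : ℝ) : ℝ := iteratedDerivWithin κ m (Set.Ici 0) a

/-- The conditions on the joint law of `(A, B)`. -/
structure LawAssumption (Q : Measure (ℝ × ℝ)) (m : ℝ → ℝ) (k : ℕ) : Prop where
  /-- `m(0) = 0`. -/
  zero : m 0 = 0
  /-- `m` is `C^k` with bounded `k`-th derivative in a neighborhood of `0` (in `[0, ∞)`). -/
  smooth : ∃ δ > 0, ContDiffOn ℝ k m (Set.Ico 0 δ) ∧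
    ∃ C : ℝ, ∀ a ∈ Set.Ico 0 δ, |derivOnNonneg m k a| ≤ C
  /-- `A` has no mass at `0`. -/
  no_mass : Q {p | p.1 = 0} = 0
  /-- `E[B ^ 4] < ∞`. -/
  fourth_moment : MemLp (fun p : ℝ × ℝ => p.2) 4 Q

/-- The conditions on the trimming thresholds `h n`. -/
structure ThresholdAssumption (h : ℕ → ℝ) (k : ℕ) : Prop where
  /-- The thresholds are positive. -/
  pos : ∀ n, 0 < h n
  /-- `h = o(1)`. -/
  tendsto_zero : Tendsto h atTop (𝓝 0)
  /-- `n h ^ (2 (k - 1)) = O(1)`. -/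
  upper : (fun n : ℕ => (n : ℝ) * h n ^ (2 * (k - 1))) =O[atTop] (fun _ : ℕ => (1 : ℝ))
  /-- `n⁻¹ h⁻⁴ = o(1)`. -/
  lower : Tendsto (fun n : ℕ => (n : ℝ)⁻¹ * (h n ^ 4)⁻¹) atTop (𝓝 0)

/-- The conditions on the estimators `mhat n κ` of `m^{(κ)}(0)` and on the influence functions
`ψ n κ`, which may depend on `n`, for `1 ≤ κ ≤ k - 1`. -/
structure InfluenceAssumption {Ω : Type*} [MeasurableSpace Ω] (μ : Measure Ω)
    (Q : Measure (ℝ × ℝ)) (X : ℕ → Ω → ℝ × ℝ) (m : ℝ → ℝ) (k : ℕ) (h : ℕ → ℝ)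
    (mhat : ℕ → ℕ → Ω → ℝ) (ψ : ℕ → ℕ → ℝ × ℝ → ℝ) : Prop where
  /-- `h ^ (κ - 1) (m̂^{(κ)}(0) - m^{(κ)}(0)) = h ^ (κ - 1) E_n[ψ_κ] + o_p(n ^ (-1/2))`. -/
  linear : ∀ κ ∈ Finset.Icc 1 (k - 1),
    TendstoInMeasure μ
      (fun (n : ℕ) ω => √(n : ℝ) * (h n ^ (κ - 1) * (mhat n κ ω - derivOnNonneg m κ 0)
        - h n ^ (κ - 1) * empMean X n (ψ n κ) ω))
      atTop (fun _ => (0 : ℝ))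
  /-- `E[ψ_κ] = 0`. -/
  centered : ∀ n, ∀ κ ∈ Finset.Icc 1 (k - 1), Integrable (ψ n κ) Q ∧ ∫ p, ψ n κ p ∂Q = 0
  /-- `E[(h ^ (κ - 1) ψ_κ) ^ 4] ^ (1/4) = O(n ^ (1/4))`. -/
  moment : ∀ κ ∈ Finset.Icc 1 (k - 1), ∃ C : ℝ, ∀ᶠ n : ℕ in atTop,
    eLpNorm (fun p => h n ^ (κ - 1) * ψ n κ p) 4 Q
      ≤ ENNReal.ofReal (C * (n : ℝ) ^ (1 / 4 : ℝ))

end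

end TrimmedRatio

/-!
The bias-corrected estimator is asymptotically linear with influence function `Z_h - E[Z_h]`, and
the row sums of the triangular array `Z_{h_n}(A_i, B_i)` satisfy Lyapunov's condition.

*Bias.* Conditioning on `A` turns the part `E[(B / A) 1{A < h}]` of `θ` that trimming removes into
`E[(m(A) / A) 1{A < h}]`. As `m(0) = 0`, Taylor's theorem gives
`m(a) / a = ∑_{κ < k} a ^ (κ - 1) m^{(κ)}(0) / κ! + O(a ^ (k - 1))`, so that the correction by the
true derivatives leaves `O(h ^ (k - 1) P(A < h))`. Times `√n` this vanishes, since
`n h ^ (2 (k - 1)) = O(1)` and `P(A < h) → P(A = 0) = 0` (`tendsto_sqrt_mul_trimming_bias`).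

*Linearization.* With `c` the coefficient `E[A ^ (κ - 1) 1{A < h}] / κ!` and `ĉ` its empirical
counterpart, `ĉ m̂ - c m = c (m̂ - m) + (ĉ - c) m + (ĉ - c) (m̂ - m)`. Here
`|c| ≤ h ^ (κ - 1) P(A < h)`, and `h ^ (1 - κ) (ĉ - c)` is `o_p(n ^ (-1/2))` because its summands
have second moment at most `P(A < h)`. Hence the first term may be replaced by `c E_n[ψ_κ]`, the
second is negligible, and so is the third, as `h ^ (κ - 1) (m̂ - m) = o_p(1)`
(`tendstoInMeasure_bias_summand`).

*Limit law.* `‖Z_h‖₄ ≤ h⁻¹ ‖B‖₄ + P(A < h) O(n ^ (1/4)) = o(n ^ (1/4))`, the first term because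
`n h ^ 4 → ∞` (`exists_eLpNorm_Z_le`). With `Var(Z_h)` bounded away from zero this is Lyapunov's
condition, and the central limit theorem for triangular arrays
(`tendstoInDistribution_sum_sub_div_sqrt_variance`) follows from the second-order expansion of the
characteristic function and Lévy's continuity theorem. Slutsky's theorem concludes.
-/

namespace TrimmedRatio

/-! ### A central limit theorem for triangular arrays -/

/-- The constant is not optimal: for `|x| ≤ 1` it bounds `exp 1`, and for `|x| ≥ 1` each of the four
terms on the left is at most `|x| ^ 3`. -/
lemma norm_exp_mul_I_sub_taylor_le (x : ℝ) :
    ‖Complex.exp (x * Complex.I) - (1 + x * Complex.I - (x : ℂ) ^ 2 / 2)‖ ≤ 4 * |x| ^ 3 := by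
  rcases le_total |x| 1 with hx | hx
  · have h := Complex.norm_exp_sub_sum_le_norm_mul_exp (x * Complex.I) 3
    have hs : ∑ i ∈ Finset.range 3, (x * Complex.I) ^ i / (i.factorial : ℂ)
        = 1 + x * Complex.I - (x : ℂ) ^ 2 / 2 := by
      simp [Finset.sum_range_succ, mul_pow, Nat.factorial]
      ring
    have hn : ‖(x : ℂ) * Complex.I‖ = |x| := by simp
    rw [hs, hn] at h
    have he : Real.exp |x| ≤ 4 :=
      (Real.exp_le_exp.2 hx).trans (Real.exp_one_lt_d9.le.trans (by norm_num))
    calc _ ≤ _ := h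
      _ ≤ |x| ^ 3 * 4 := by gcongr
      _ = _ := by ring
  · have h1 : ‖Complex.exp (x * Complex.I)‖ = 1 := Complex.norm_exp_ofReal_mul_I x
    have h2 : ‖1 + x * Complex.I - (x : ℂ) ^ 2 / 2‖ ≤ 1 + |x| + |x| ^ 2 / 2 := by
      refine (norm_sub_le _ _).trans (add_le_add ((norm_add_le _ _).trans ?_) ?_) <;> simp
    have h3 : |x| ≤ |x| ^ 3 := le_self_pow₀ hx (by norm_num)
    have h4 : |x| ^ 2 ≤ |x| ^ 3 := pow_le_pow_right₀ hx (by norm_num)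
    calc _ ≤ _ := norm_sub_le _ _
      _ ≤ 1 + (1 + |x| + |x| ^ 2 / 2) := by rw [h1]; gcongr
      _ ≤ _ := by linarith

/-- Second-order expansion of the characteristic function of a standardized variable. The cubic
remainder is split by `|u| ^ 3 ≤ ε u ^ 2 + u ^ 4 / ε`, so that only the second and the fourth moment
enter. -/
lemma norm_integral_exp_sub_le {E : Type*} [MeasurableSpace E] {Q : Measure E}
    [IsProbabilityMeasure Q] {g : E → ℝ} (hg : MemLp g 4 Q) (h0 : ∫ p, g p ∂Q = 0)
    (h1 : ∫ p, g p ^ 2 ∂Q = 1) (s : ℝ) {ε : ℝ} (hε : 0 < ε) :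
    ‖(∫ p, Complex.exp ((s * g p : ℝ) * Complex.I) ∂Q) - (1 - (s : ℂ) ^ 2 / 2)‖
      ≤ 4 * (ε * s ^ 2 + s ^ 4 * (∫ p, g p ^ 4 ∂Q) / ε) := by
  have hg2 : MemLp g 2 Q := hg.mono_exponent (by norm_num)
  have hi1 : Integrable g Q := hg.integrable (by norm_num)
  have hi2 : Integrable (fun p => g p ^ 2) Q := hg2.integrable_sq
  have hi4 : Integrable (fun p => g p ^ 4) Q := by
    have h := MemLp.integrable_norm_pow (p := 4) (f := g) (μ := Q) (by simpa using hg) four_ne_zero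
    simpa only [Real.norm_eq_abs, Even.pow_abs (show Even 4 by decide)] using h
  have hie : Integrable (fun p => Complex.exp ((s * g p : ℝ) * Complex.I)) Q := by
    refine Integrable.of_bound ?_ 1 (ae_of_all _ fun p => (Complex.norm_exp_ofReal_mul_I _).le)
    have := hg.aestronglyMeasurable.aemeasurable
    exact AEMeasurable.aestronglyMeasurable (by fun_prop)
  have hi1c : Integrable (fun p => (g p : ℂ)) Q := hi1.ofReal
  have hi2c : Integrable (fun p => (g p : ℂ) ^ 2) Q := by simpa using hi2.ofReal (𝕜 := ℂ)
  have hA : Integrable (fun p => (1 : ℂ) + (s * Complex.I) * (g p : ℂ)) Q :=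
    (integrable_const _).add (hi1c.const_mul _)
  have hB : Integrable (fun p => ((s : ℂ) ^ 2 / 2) * (g p : ℂ) ^ 2) Q := hi2c.const_mul _
  have hT : ∫ p, ((1 : ℂ) + (s * Complex.I) * (g p : ℂ) - ((s : ℂ) ^ 2 / 2) * (g p : ℂ) ^ 2) ∂Q
      = 1 - (s : ℂ) ^ 2 / 2 := by
    have e1 : ∫ p, (g p : ℂ) ∂Q = 0 := by rw [integral_complex_ofReal, h0]; simp
    have e2 : ∫ p, (g p : ℂ) ^ 2 ∂Q = 1 := by
      have := integral_complex_ofReal (μ := Q) (f := fun p => g p ^ 2)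
      rw [h1] at this
      simpa using this
    rw [integral_sub hA hB, integral_add (integrable_const _) (hi1c.const_mul _),
      integral_const_mul, integral_const_mul, e1, e2]
    simp
  have hAB : Integrable (fun p => (1 : ℂ) + (s * Complex.I) * (g p : ℂ)
      - ((s : ℂ) ^ 2 / 2) * (g p : ℂ) ^ 2) Q := hA.sub hB
  -- The second-order term integrates to `1 - s ^ 2 / 2`, so it remains to integrate the remainder.
  rw [← hT, ← integral_sub hie hAB]
  calc _ ≤ ∫ p, 4 * (ε * s ^ 2 * g p ^ 2 + s ^ 4 / ε * g p ^ 4) ∂Q := by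
        refine norm_integral_le_of_norm_le
          (((hi2.const_mul _).add (hi4.const_mul _)).const_mul _) (ae_of_all _ fun p => ?_)
        have h := norm_exp_mul_I_sub_taylor_le (s * g p)
        have hcube : |s * g p| ^ 3 ≤ ε * (s * g p) ^ 2 + (s * g p) ^ 4 / ε := by
          rw [← sq_abs (s * g p), ← Even.pow_abs (show Even 4 by decide) (s * g p)]
          set u := |s * g p|
          have : 0 ≤ (ε - u) ^ 2 + ε * u := by positivity
          have h2 : u ^ 3 * ε ≤ (ε * u ^ 2 + u ^ 4 / ε) * ε := by
            have : (ε * u ^ 2 + u ^ 4 / ε) * ε = u ^ 2 * (ε ^ 2 + u ^ 2) := by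
              field_simp
            rw [this]
            nlinarith [mul_nonneg (sq_nonneg u) ‹0 ≤ (ε - u) ^ 2 + ε * u›]
          exact le_of_mul_le_mul_right h2 hε
        have heq : Complex.exp ((s * g p : ℝ) * Complex.I)
            - (1 + (s * Complex.I) * (g p : ℂ) - ((s : ℂ) ^ 2 / 2) * (g p : ℂ) ^ 2)
            = Complex.exp ((s * g p : ℝ) * Complex.I)
            - (1 + (s * g p : ℝ) * Complex.I - ((s * g p : ℝ) : ℂ) ^ 2 / 2) := by
          push_cast; ring
        rw [heq]
        refine h.trans ?_
        calc 4 * |s * g p| ^ 3 ≤ 4 * (ε * (s * g p) ^ 2 + (s * g p) ^ 4 / ε) := by gcongr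
          _ = _ := by ring
    _ = _ := by
        rw [integral_const_mul, integral_add (hi2.const_mul _) (hi4.const_mul _),
          integral_const_mul, integral_const_mul, h1]
        ring

section IID

variable {Ω E : Type*} [MeasurableSpace Ω] [MeasurableSpace E] {μ : Measure Ω}
  {Q : Measure E} {X : ℕ → Ω → E}

lemma charFun_inv_sqrt_mul_sum_comp (hXlaw : ∀ i, HasLaw (X i) Q μ) (hXindep : iIndepFun X μ)
    {g : E → ℝ} (hg : Measurable g) (n : ℕ) (t : ℝ) :
    charFun (μ.map fun ω => (√(n : ℝ))⁻¹ * ∑ i ∈ Finset.range n, g (X i ω)) t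
      = (∫ p, Complex.exp (((√(n : ℝ))⁻¹ * t * g p : ℝ) * Complex.I) ∂Q) ^ n := by
  have hX i := (hXlaw i).aemeasurable
  have hgX i : AEMeasurable (fun ω => g (X i ω)) μ := hg.comp_aemeasurable (hX i)
  rw [charFun_map_mul_comp (Finset.aemeasurable_fun_sum _ fun i _ => hgX i),
    ((hXindep.comp (fun _ => g) fun _ => hg).restrict _).charFun_map_fun_finsetSum_eq_prod
      fun i _ => hgX i]
  have (i : ℕ) : charFun (μ.map (g ∘ X i)) ((√(n : ℝ))⁻¹ * t)
      = ∫ p, Complex.exp (((√(n : ℝ))⁻¹ * t * g p : ℝ) * Complex.I) ∂Q := by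
    rw [← AEMeasurable.map_map_of_aemeasurable hg.aemeasurable (hX i), (hXlaw i).map_eq,
      charFun_apply_real, integral_map hg.aemeasurable (by fun_prop)]
    simp
  rw [Finset.prod_apply]
  refine (Finset.prod_congr rfl fun i _ => this i).trans ?_
  rw [Finset.prod_const, Finset.card_range]

variable [IsProbabilityMeasure μ] [IsProbabilityMeasure Q]

/-- **Lyapunov's central limit theorem** for the row sums of a triangular array whose `n`-th row is
`g n (X 0), …, g n (X (n - 1))`, in standardized form. -/
lemma tendstoInDistribution_inv_sqrt_mul_sum_comp (hXlaw : ∀ i, HasLaw (X i) Q μ)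
    (hXindep : iIndepFun X μ) {g : ℕ → E → ℝ} (hg : ∀ n, Measurable (g n))
    (h4 : ∀ᶠ n in atTop, MemLp (g n) 4 Q) (h0 : ∀ᶠ n in atTop, ∫ p, g n p ∂Q = 0)
    (h1 : ∀ᶠ n in atTop, ∫ p, g n p ^ 2 ∂Q = 1)
    (hlyap : Tendsto (fun n : ℕ => (∫ p, g n p ^ 4 ∂Q) / n) atTop (𝓝 0)) :
    TendstoInDistribution
      (fun (n : ℕ) ω => (√(n : ℝ))⁻¹ * ∑ i ∈ Finset.range n, g n (X i ω))
      atTop (id : ℝ → ℝ) (fun _ => μ) (gaussianReal 0 1) where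
  forall_aemeasurable n := by
    have hX i := (hXlaw i).aemeasurable
    exact .const_mul (Finset.aemeasurable_fun_sum _ fun i _ => (hg n).comp_aemeasurable (hX i)) _
  tendsto := by
    refine ProbabilityMeasure.tendsto_iff_tendsto_charFun.2 fun t => ?_
    simp only [ProbabilityMeasure.coe_mk, Measure.map_id, charFun_gaussianReal,
      charFun_inv_sqrt_mul_sum_comp hXlaw hXindep (hg _)]
    have : Complex.exp (t * (0 : ℝ) * Complex.I - ((1 : NNReal) : ℝ) * (t : ℂ) ^ 2 / 2)
        = Complex.exp (-(t : ℂ) ^ 2 / 2) := by simp [neg_div]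
    rw [this]
    apply Complex.tendsto_pow_exp_of_isLittleO_sub_add_div
    rw [isLittleO_iff]
    intro c hc
    -- `ε` makes the second-moment part of the remainder at most `c / 2`; the fourth-moment part then
    -- vanishes by the Lyapunov condition.
    obtain ⟨ε, hε, hεc⟩ : ∃ ε > 0, 4 * (ε * t ^ 2) ≤ c / 2 := by
      refine ⟨c / (8 * (t ^ 2 + 1)), by positivity, ?_⟩
      rw [show 4 * (c / (8 * (t ^ 2 + 1)) * t ^ 2) = c / 2 * (t ^ 2 / (t ^ 2 + 1)) by
        field_simp; ring]
      exact mul_le_of_le_one_right (by positivity) ((div_le_one (by positivity)).2 (by linarith))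
    have hl : ∀ᶠ n : ℕ in atTop, 4 * t ^ 4 / ε * ((∫ p, g n p ^ 4 ∂Q) / n) ≤ c / 2 := by
      have := hlyap.const_mul (4 * t ^ 4 / ε)
      rw [mul_zero] at this
      exact this.eventually_le_const (by positivity)
    filter_upwards [h4, h0, h1, hl, eventually_ge_atTop 1] with n hn4 hn0 hn1 hnl hn
    have hn' : (0 : ℝ) < n := by exact_mod_cast hn
    have hb := norm_integral_exp_sub_le hn4 hn0 hn1 ((√(n : ℝ))⁻¹ * t) hε
    have hs : ((√(n : ℝ))⁻¹) ^ 2 = (n : ℝ)⁻¹ := by rw [inv_pow, Real.sq_sqrt hn'.le]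
    have hs4 : ((√(n : ℝ))⁻¹) ^ 4 = (n : ℝ)⁻¹ ^ 2 := by
      rw [← hs]; ring
    have hsc : (((√(n : ℝ))⁻¹ * t : ℝ) : ℂ) ^ 2 = t ^ 2 / n := by
      rw [← Complex.ofReal_pow, mul_pow, hs]; push_cast; ring
    rw [hsc, mul_pow, mul_pow, hs, hs4] at hb
    have e : (1 : ℂ) + -(t : ℂ) ^ 2 / 2 / n = 1 - t ^ 2 / n / 2 := by ring
    rw [e]
    refine hb.trans ?_
    have hr : ‖(1 / n : ℂ)‖ = (n : ℝ)⁻¹ := by simp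
    rw [hr]
    calc _ = (4 * (ε * t ^ 2) + 4 * t ^ 4 / ε * ((∫ p, g n p ^ 4 ∂Q) / n)) * (n : ℝ)⁻¹ := by
          field_simp
      _ ≤ (c / 2 + c / 2) * (n : ℝ)⁻¹ := by gcongr
      _ = _ := by ring

/-- **Lyapunov's central limit theorem** for the row sums of a triangular array, with the variances
bounded away from zero. -/
lemma tendstoInDistribution_sum_sub_div_sqrt_variance (hXlaw : ∀ i, HasLaw (X i) Q μ)
    (hXindep : iIndepFun X μ) {g : ℕ → E → ℝ} (hg : ∀ n, Measurable (g n))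
    (h4 : ∀ᶠ n in atTop, MemLp (g n) 4 Q) {c : ℝ} (hc : 0 < c)
    (hvar : ∀ᶠ n in atTop, c ≤ Var[g n; Q])
    (hlyap : Tendsto (fun n : ℕ => (∫ p, (g n p - ∫ q, g n q ∂Q) ^ 4 ∂Q) / n) atTop (𝓝 0)) :
    TendstoInDistribution
      (fun (n : ℕ) ω => (√(n : ℝ))⁻¹ *
        ∑ i ∈ Finset.range n, (g n (X i ω) - ∫ q, g n q ∂Q) / √Var[g n; Q])
      atTop (id : ℝ → ℝ) (fun _ => μ) (gaussianReal 0 1) := by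
  refine tendstoInDistribution_inv_sqrt_mul_sum_comp hXlaw hXindep
    (g := fun n p => (g n p - ∫ q, g n q ∂Q) / √Var[g n; Q])
    (fun n => ((hg n).sub_const _).div_const _) ?_ ?_ ?_ ?_
  · filter_upwards [h4] with n hn
    simpa [div_eq_inv_mul] using (hn.sub (memLp_const _)).const_mul (√Var[g n; Q])⁻¹
  · filter_upwards [h4] with n hn
    rw [integral_div, integral_sub (hn.integrable (by norm_num)) (integrable_const _)]
    simp
  · filter_upwards [hvar] with n hn
    simp_rw [div_pow]
    rw [integral_div, Real.sq_sqrt (variance_nonneg _ _),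
      ← variance_eq_integral (hg n).aemeasurable, div_self (hc.trans_le hn).ne']
  · refine squeeze_zero' (g := fun n : ℕ =>
      (c ^ 2)⁻¹ * ((∫ p, (g n p - ∫ q, g n q ∂Q) ^ 4 ∂Q) / n)) (.of_forall fun n => ?_) ?_
      (by simpa using hlyap.const_mul (c ^ 2)⁻¹)
    · positivity
    · filter_upwards [hvar] with n hn
      have hv : √Var[g n; Q] ^ 4 = Var[g n; Q] ^ 2 := by
        rw [show 4 = 2 * 2 from rfl, pow_mul, Real.sq_sqrt (variance_nonneg _ _)]
      simp_rw [div_pow]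
      rw [integral_div, hv, div_right_comm, div_eq_inv_mul]
      gcongr

/-! ### Convergence in probability -/

/-- Centered empirical means of functions `f n` with vanishing second moments are `o_p(n ^ (-1/2))`,
by Chebyshev's inequality. -/
lemma tendstoInMeasure_sqrt_mul_sub_integral (hXlaw : ∀ i, HasLaw (X i) Q μ)
    (hXindep : iIndepFun X μ) {f : ℕ → E → ℝ} (hf : ∀ᶠ n in atTop, MemLp (f n) 2 Q)
    (hlim : Tendsto (fun n => ∫ p, f n p ^ 2 ∂Q) atTop (𝓝 0)) :
    TendstoInMeasure μ (fun (n : ℕ) ω =>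
      √(n : ℝ) * ((n : ℝ)⁻¹ * ∑ i ∈ Finset.range n, f n (X i ω) - ∫ p, f n p ∂Q)) atTop
      (fun _ => (0 : ℝ)) := by
  rw [tendstoInMeasure_iff_norm]
  intro ε hε
  refine tendsto_of_tendsto_of_tendsto_of_le_of_le' tendsto_const_nhds
    (h := fun n => ENNReal.ofReal ((∫ p, f n p ^ 2 ∂Q) / ε ^ 2)) ?_ (.of_forall fun _ => zero_le) ?_
  · simpa using ENNReal.tendsto_ofReal (hlim.div_const (ε ^ 2))
  · filter_upwards [hf, eventually_ge_atTop 1] with n hn hn1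
    have hn' : (0 : ℝ) < n := by exact_mod_cast hn1
    have hXi i := (hXlaw i).aemeasurable
    have hL i : MemLp (f n ∘ X i) 2 μ := by
      refine (memLp_map_measure_iff ?_ (hXi i)).1 ?_ <;> rw [(hXlaw i).map_eq]
      exacts [hn.aestronglyMeasurable, hn]
    have hint i : ∫ ω, (f n ∘ X i) ω ∂μ = ∫ p, f n p ∂Q :=
      (hXlaw i).integral_comp hn.aestronglyMeasurable
    have hvar i : Var[f n ∘ X i; μ] = Var[f n; Q] := by
      rw [← variance_map ?_ (hXi i), (hXlaw i).map_eq]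
      rw [(hXlaw i).map_eq]; exact hn.aestronglyMeasurable.aemeasurable
    have hind : Set.Pairwise ↑(Finset.range n) fun i j => (f n ∘ X i) ⟂ᵢ[μ] (f n ∘ X j) := by
      intro i _ j _ hij
      refine (hXindep.indepFun hij).comp₀ (hXi i) (hXi j) ?_ ?_ <;> rw [(hXlaw _).map_eq] <;>
        exact hn.aestronglyMeasurable.aemeasurable
    set S : Ω → ℝ := ∑ i ∈ Finset.range n, f n ∘ X i with hS
    have hSL : MemLp ((√(n : ℝ))⁻¹ • S) 2 μ := (memLp_finsetSum' _ fun i _ => hL i).const_smul _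
    have hSv : Var[(√(n : ℝ))⁻¹ • S; μ] = Var[f n; Q] := by
      rw [variance_smul, hS, IndepFun.variance_sum (fun i _ => hL i) hind]
      simp only [hvar, Finset.sum_const, Finset.card_range, nsmul_eq_mul, inv_pow]
      rw [Real.sq_sqrt hn'.le]
      field_simp
    have hSi : ∫ ω, ((√(n : ℝ))⁻¹ • S) ω ∂μ = √(n : ℝ) * ∫ p, f n p ∂Q := by
      simp only [Pi.smul_apply, smul_eq_mul, hS, Finset.sum_apply]
      rw [integral_const_mul, integral_finsetSum _ fun i _ => (hL i).integrable (by norm_num)]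
      simp only [hint, Finset.sum_const, Finset.card_range, nsmul_eq_mul]
      have := Real.mul_self_sqrt hn'.le
      field_simp
      rw [sq, this]
    refine le_trans (le_of_eq ?_) ((meas_ge_le_variance_div_sq hSL hε).trans
      (ENNReal.ofReal_le_ofReal ?_))
    · congr 1
      ext ω
      simp only [sub_zero, Real.norm_eq_abs, Set.mem_ofPred_eq]
      rw [hSi]
      have : √(n : ℝ) * ((n : ℝ)⁻¹ * ∑ i ∈ Finset.range n, f n (X i ω) - ∫ p, f n p ∂Q)
          = ((√(n : ℝ))⁻¹ • S) ω - √(n : ℝ) * ∫ p, f n p ∂Q := by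
        simp only [Pi.smul_apply, smul_eq_mul, hS, Finset.sum_apply, Function.comp]
        rw [mul_sub, ← mul_assoc, ← div_eq_mul_inv, Real.sqrt_div_self]
      rw [this]
    · rw [hSv]
      gcongr
      exact variance_le_expectation_sq hn.aestronglyMeasurable

end IID

section InMeasure

variable {Ω ι : Type*} [MeasurableSpace Ω] {μ : Measure Ω} {l : Filter ι}

lemma _root_.MeasureTheory.TendstoInMeasure.add_of_zero {f g : ι → Ω → ℝ}
    (hf : TendstoInMeasure μ f l fun _ => (0 : ℝ)) (hg : TendstoInMeasure μ g l fun _ => (0 : ℝ)) :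
    TendstoInMeasure μ (fun n ω => f n ω + g n ω) l fun _ => (0 : ℝ) := by
  rw [tendstoInMeasure_iff_norm] at *
  intro ε hε
  have := (hf (ε / 2) (by positivity)).add (hg (ε / 2) (by positivity))
  rw [zero_add] at this
  refine tendsto_of_tendsto_of_tendsto_of_le_of_le tendsto_const_nhds this (fun _ => zero_le)
    fun n => (measure_mono fun ω hω => ?_).trans (measure_union_le _ _)
  simp only [sub_zero, Set.mem_ofPred_eq, Set.mem_union] at *
  by_contra! h
  linarith [norm_add_le (f n ω) (g n ω)]

lemma _root_.MeasureTheory.TendstoInMeasure.sum_of_zero {κ : Type*} (s : Finset κ)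
    {f : κ → ι → Ω → ℝ} (hf : ∀ j ∈ s, TendstoInMeasure μ (f j) l fun _ => (0 : ℝ)) :
    TendstoInMeasure μ (fun n ω => ∑ j ∈ s, f j n ω) l fun _ => (0 : ℝ) := by
  classical
  induction s using Finset.induction_on with
  | empty =>
    rw [tendstoInMeasure_iff_norm]
    intro ε hε
    simpa [hε.not_ge] using tendsto_const_nhds
  | insert j s hj ih =>
    simp_rw [Finset.sum_insert hj]
    exact (hf j (by simp)).add_of_zero (ih fun i hi => hf i (by simp [hi]))

lemma _root_.MeasureTheory.TendstoInMeasure.mul_of_zero {f g : ι → Ω → ℝ}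
    (hf : TendstoInMeasure μ f l fun _ => (0 : ℝ)) (hg : TendstoInMeasure μ g l fun _ => (0 : ℝ)) :
    TendstoInMeasure μ (fun n ω => f n ω * g n ω) l fun _ => (0 : ℝ) := by
  rw [tendstoInMeasure_iff_norm] at *
  intro ε hε
  have := (hf ε hε).add (hg 1 one_pos)
  rw [zero_add] at this
  refine tendsto_of_tendsto_of_tendsto_of_le_of_le tendsto_const_nhds this (fun _ => zero_le)
    fun n => (measure_mono fun ω hω => ?_).trans (measure_union_le _ _)
  simp only [sub_zero, Set.mem_ofPred_eq, Set.mem_union, norm_mul] at *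
  by_contra! h
  have := mul_le_of_le_one_right (norm_nonneg (f n ω)) h.2.le
  linarith

lemma _root_.MeasureTheory.TendstoInMeasure.const_mul_of_zero {a : ι → ℝ} {C : ℝ}
    (ha : ∀ᶠ n in l, |a n| ≤ C) {f : ι → Ω → ℝ} (hf : TendstoInMeasure μ f l fun _ => (0 : ℝ)) :
    TendstoInMeasure μ (fun n ω => a n * f n ω) l fun _ => (0 : ℝ) := by
  rw [tendstoInMeasure_iff_norm] at *
  intro ε hε
  have hC : 0 < |C| + 1 := by positivity
  refine tendsto_of_tendsto_of_tendsto_of_le_of_le' tendsto_const_nhds (hf (ε / (|C| + 1))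
    (by positivity)) (.of_forall fun _ => zero_le) ?_
  filter_upwards [ha] with n hn
  refine measure_mono fun ω hω => ?_
  simp only [sub_zero, Set.mem_ofPred_eq, norm_mul] at *
  rw [div_le_iff₀' hC]
  refine hω.trans ?_
  gcongr
  exact hn.trans ((le_abs_self C).trans (by linarith))

lemma tendstoInMeasure_of_tendsto_const {a : ι → ℝ} (ha : Tendsto a l (𝓝 0)) :
    TendstoInMeasure μ (fun n _ => a n) l fun _ => (0 : ℝ) := by
  rw [tendstoInMeasure_iff_norm]
  intro ε hε
  refine tendsto_const_nhds.congr' ?_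
  filter_upwards [(tendsto_zero_iff_norm_tendsto_zero.1 ha).eventually_lt_const hε] with n hn
  exact (measure_mono_null (t := ∅) (fun _ hx => absurd (by simpa using hx) hn.not_ge)
    measure_empty).symm

end InMeasure

/-! ### Moments -/

section Moments

variable {E : Type*} [MeasurableSpace E] {Q : Measure E}

lemma integral_abs_pow_le_of_eLpNorm_le {f : E → ℝ} (hf : AEStronglyMeasurable f Q) {p : ℕ}
    (hp : p ≠ 0) {b : ℝ} (hb : 0 ≤ b) (h : eLpNorm f p Q ≤ ENNReal.ofReal b) :
    ∫ x, |f x| ^ p ∂Q ≤ b ^ p := by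
  have hL : MemLp f p Q := ⟨hf, h.trans_lt ENNReal.ofReal_lt_top⟩
  rw [hL.eLpNorm_eq_integral_rpow_norm (by simpa using hp) (by simp),
    ENNReal.ofReal_le_ofReal_iff hb] at h
  simp only [ENNReal.toReal_natCast, Real.norm_eq_abs, Real.rpow_natCast] at h
  have h0 : 0 ≤ ∫ x, |f x| ^ p ∂Q := integral_nonneg fun x => by positivity
  calc _ = ((∫ x, |f x| ^ p ∂Q) ^ ((p : ℝ)⁻¹)) ^ p := (Real.rpow_inv_natCast_pow h0 hp).symm
    _ ≤ _ := by gcongr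

lemma eLpNorm_sub_integral_le [IsProbabilityMeasure Q] {f : E → ℝ} (hf : AEStronglyMeasurable f Q)
    {p : ENNReal} (hp : 1 ≤ p) :
    eLpNorm (fun x => f x - ∫ y, f y ∂Q) p Q ≤ 2 * eLpNorm f p Q := by
  have hm : ‖∫ y, f y ∂Q‖ₑ ≤ eLpNorm f p Q :=
    (enorm_integral_le_lintegral_enorm f).trans (by
      rw [← eLpNorm_one_eq_lintegral_enorm]
      exact eLpNorm_le_eLpNorm_of_exponent_le hp hf)
  have hp0 : p ≠ 0 := (one_pos.trans_le hp).ne'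
  refine (eLpNorm_sub_le hf aestronglyMeasurable_const hp).trans ?_
  rw [eLpNorm_const _ hp0 (IsProbabilityMeasure.ne_zero Q), two_mul]
  simpa using add_le_add_right hm _

end Moments

/-! ### The trimming functions -/

@[fun_prop]
lemma measurable_trimmedRatio (h : ℝ) : Measurable (trimmedRatio h) :=
  (measurable_snd.div measurable_fst).indicator (measurableSet_le measurable_const measurable_fst)

@[fun_prop]
lemma measurable_trimmedPower (h : ℝ) (κ : ℕ) : Measurable (trimmedPower h κ) :=
  (measurable_fst.pow_const _).indicator (measurableSet_lt measurable_fst measurable_const)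

section Trimming

variable {Q : Measure (ℝ × ℝ)}

lemma integral_indicator_fst_lt (h c : ℝ) :
    ∫ p, {p : ℝ × ℝ | p.1 < h}.indicator (fun _ => c) p ∂Q = c * Q.real {p | p.1 < h} := by
  rw [integral_indicator_const _ (measurableSet_lt measurable_fst measurable_const), smul_eq_mul,
    mul_comm]

variable [IsProbabilityMeasure Q]

lemma tendsto_measureReal_fst_lt (hA : ∀ᵐ p ∂Q, 0 ≤ p.1) (h0 : Q {p | p.1 = 0} = 0)
    {h : ℕ → ℝ} (hpos : ∀ n, 0 < h n) (hlim : Tendsto h atTop (𝓝 0)) :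
    Tendsto (fun n => Q.real {p | p.1 < h n}) atTop (𝓝 0) := by
  -- `{A ≤ 0}`, the intersection of the events `{A < r}`, is null because `A ≥ 0` and `P(A = 0) = 0`.
  have hz : Q (⋂ r : ℝ, ⋂ _ : r > 0, {p : ℝ × ℝ | p.1 < r}) = 0 := by
    refine measure_mono_null (t := {p | p.1 = 0} ∪ {p | ¬ 0 ≤ p.1}) (fun p hp => ?_)
      (measure_union_null h0 hA)
    simp only [Set.mem_iInter, Set.mem_ofPred_eq, Set.mem_union, not_le] at *
    exact or_comm.1 (le_of_forall_gt hp).lt_or_eq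
  have ht := tendsto_measure_biInter_gt (μ := Q) (s := fun r : ℝ => {p : ℝ × ℝ | p.1 < r}) (a := 0)
    (fun r _ => (measurableSet_lt measurable_fst measurable_const).nullMeasurableSet)
    (fun i j _ hij p hp => lt_of_lt_of_le hp hij) ⟨1, one_pos, measure_ne_top _ _⟩
  rw [hz] at ht
  have ht' := ht.comp (tendsto_nhdsWithin_iff.2 ⟨hlim, .of_forall hpos⟩)
  exact (ENNReal.tendsto_toReal ENNReal.zero_ne_top).comp ht'

lemma integrable_indicator_fst_lt (h c : ℝ) :
    Integrable ({p : ℝ × ℝ | p.1 < h}.indicator (fun _ => c)) Q :=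
  (integrable_const c).indicator (measurableSet_lt measurable_fst measurable_const)

lemma trimmedPower_nonneg (h : ℝ) (κ : ℕ) {p : ℝ × ℝ} (hp : 0 ≤ p.1) :
    0 ≤ trimmedPower h κ p := by
  by_cases hlt : p.1 < h
  · simpa [trimmedPower, hlt] using pow_nonneg hp _
  · simp [trimmedPower, hlt]

lemma trimmedPower_pow_le (h : ℝ) (κ j : ℕ) (hj : j ≠ 0) {p : ℝ × ℝ} (hp : 0 ≤ p.1) :
    trimmedPower h κ p ^ j ≤ {p : ℝ × ℝ | p.1 < h}.indicator (fun _ => (h ^ (κ - 1)) ^ j) p := by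
  by_cases hlt : p.1 < h
  · simp only [trimmedPower, Set.indicator, Set.mem_ofPred_eq, hlt, if_true]
    gcongr
  · simp [trimmedPower, hlt, hj]

lemma integral_trimmedPower_pow_le (hA : ∀ᵐ p ∂Q, 0 ≤ p.1) (h : ℝ) (κ : ℕ) {j : ℕ} (hj : j ≠ 0) :
    ∫ p, trimmedPower h κ p ^ j ∂Q ≤ (h ^ (κ - 1)) ^ j * Q.real {p | p.1 < h} := by
  rw [← integral_indicator_fst_lt]
  refine integral_mono_of_nonneg ?_ (integrable_indicator_fst_lt _ _) ?_
  · filter_upwards [hA] with p hp using pow_nonneg (trimmedPower_nonneg h κ hp) j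
  · filter_upwards [hA] with p hp using trimmedPower_pow_le h κ j hj hp

lemma memLp_trimmedPower (hA : ∀ᵐ p ∂Q, 0 ≤ p.1) {h : ℝ} (hh : 0 < h) (κ : ℕ) (q : ENNReal) :
    MemLp (trimmedPower h κ) q Q := by
  refine MemLp.of_bound (measurable_trimmedPower h κ).aestronglyMeasurable (h ^ (κ - 1)) ?_
  filter_upwards [hA] with p hp
  rw [Real.norm_of_nonneg (trimmedPower_nonneg h κ hp)]
  have := trimmedPower_pow_le h κ 1 one_ne_zero hp
  rw [pow_one] at this
  refine this.trans (Set.indicator_le_self' (fun _ _ => by positivity) p |>.trans (by simp))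

lemma abs_coeff_le (hA : ∀ᵐ p ∂Q, 0 ≤ p.1) (h : ℝ) (κ : ℕ) :
    |coeff Q h κ| ≤ h ^ (κ - 1) * Q.real {p | p.1 < h} := by
  have h0 : 0 ≤ ∫ p, trimmedPower h κ p ∂Q := integral_nonneg_of_ae (by
    filter_upwards [hA] with p hp using trimmedPower_nonneg h κ hp)
  have h1 := integral_trimmedPower_pow_le hA h κ one_ne_zero
  simp only [pow_one] at h1
  have hf : (1 : ℝ) ≤ κ.factorial := by exact_mod_cast κ.factorial_pos
  rw [coeff, abs_of_nonneg (by positivity)]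
  exact (div_le_self h0 hf).trans h1

/-! ### The trimming bias -/

/-- The derivatives at `0` along `[0, b]` are those along `[0, ∞)`, the two intervals agreeing near
`0`. -/
lemma derivOnNonneg_zero_eq {m : ℝ → ℝ} {b : ℝ} (hb : 0 < b) (κ : ℕ) :
    iteratedDerivWithin κ m (Set.Icc 0 b) 0 = derivOnNonneg m κ 0 := by
  rw [derivOnNonneg, iteratedDerivWithin_eq_iteratedFDerivWithin,
    iteratedDerivWithin_eq_iteratedFDerivWithin, iteratedFDerivWithin_congr_set]
  filter_upwards [Iio_mem_nhds hb] with x hx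
  have hx' : x ≤ b := le_of_lt hx
  exact propext ⟨fun h => h.1, fun h => ⟨h, hx'⟩⟩

/-- Taylor's theorem for `m(a) / a` at `0`, where `m(0) = 0`. -/
lemma exists_abs_div_sub_taylor_le {m : ℝ → ℝ} {k : ℕ} (hk : 1 ≤ k) (h0 : m 0 = 0) {δ : ℝ}
    (hδ : 0 < δ) (hm : ContDiffOn ℝ k m (Set.Ico 0 δ)) :
    ∃ b > 0, ∃ C ≥ 0, ∀ a, 0 < a → a ≤ b →
      |m a / a - ∑ κ ∈ Finset.Icc 1 (k - 1), a ^ (κ - 1) / (κ.factorial : ℝ) * derivOnNonneg m κ 0|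
        ≤ C * a ^ (k - 1) := by
  obtain ⟨j, rfl⟩ : ∃ j, k = j + 1 := ⟨k - 1, by omega⟩
  have hb : 0 < δ / 2 := by positivity
  have hm' : ContDiffOn ℝ (j + 1) m (Set.Icc 0 (δ / 2)) := by
    have hm1 : ContDiffOn ℝ (j + 1) m (Set.Ico 0 δ) := by exact_mod_cast hm
    exact hm1.mono fun x hx => ⟨hx.1, hx.2.trans_lt (by linarith)⟩
  obtain ⟨C, hC⟩ := exists_taylor_mean_remainder_bound hb.le hm'
  refine ⟨δ / 2, hb, |C|, abs_nonneg _, fun a ha hab => ?_⟩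
  have h1 := hC a ⟨ha.le, hab⟩
  have hI : Finset.Ico 1 (j + 1) = Finset.Icc 1 j := by ext; simp
  rw [taylor_within_apply, Finset.range_eq_Ico, Finset.sum_eq_sum_Ico_succ_bot (by omega), zero_add,
    hI, iteratedDerivWithin_zero, h0, smul_zero, zero_add, sub_zero, Real.norm_eq_abs] at h1
  rw [Nat.add_sub_cancel]
  have h2 : m a / a - ∑ κ ∈ Finset.Icc 1 j, a ^ (κ - 1) / (κ.factorial : ℝ) * derivOnNonneg m κ 0
      = (m a - ∑ κ ∈ Finset.Icc 1 j,
        ((κ.factorial : ℝ)⁻¹ * a ^ κ) • iteratedDerivWithin κ m (Set.Icc 0 (δ / 2)) 0) / a := by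
    rw [sub_div, Finset.sum_div]
    congr 1
    refine Finset.sum_congr rfl fun κ hκ => ?_
    obtain ⟨i, rfl⟩ : ∃ i, κ = i + 1 := ⟨κ - 1, by have := (Finset.mem_Icc.1 hκ).1; omega⟩
    rw [derivOnNonneg_zero_eq hb, smul_eq_mul, Nat.add_sub_cancel, pow_succ]
    field_simp
  rw [h2, abs_div, abs_of_pos ha, div_le_iff₀ ha]
  calc _ ≤ _ := h1
    _ ≤ |C| * a ^ (j + 1) := by gcongr; exact le_abs_self C
    _ = _ := by ring

/-- Conditioning on `A` replaces `B` by `m(A)` in the part of `E[B / A]` that trimming removes. -/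
lemma integral_indicator_div_eq (hint : Integrable (fun p : ℝ × ℝ => p.2 / p.1) Q)
    (hB : Integrable (fun p : ℝ × ℝ => p.2) Q) {m : ℝ → ℝ} (hm : IsCondMean Q m) (h : ℝ) :
    Integrable ({p : ℝ × ℝ | p.1 < h}.indicator fun p => m p.1 / p.1) Q ∧
      ∫ p, {p : ℝ × ℝ | p.1 < h}.indicator (fun p => p.2 / p.1) p ∂Q
        = ∫ p, {p : ℝ × ℝ | p.1 < h}.indicator (fun p => m p.1 / p.1) p ∂Q := by
  have hFle : MeasurableSpace.comap (fun p : ℝ × ℝ => p.1) inferInstance ≤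
      (inferInstance : MeasurableSpace (ℝ × ℝ)) :=
    measurable_fst.comap_le
  set f : ℝ × ℝ → ℝ := fun p => (Set.Iio h).indicator (fun a => a⁻¹) p.1 with hf
  have hfm :
      StronglyMeasurable[MeasurableSpace.comap (fun p : ℝ × ℝ => p.1) inferInstance] f := by
    have : Measurable ((Set.Iio h).indicator fun a : ℝ => a⁻¹) :=
      measurable_inv.indicator measurableSet_Iio
    exact (this.comp (comap_measurable _)).stronglyMeasurable
  have e1 : f * (fun p => p.2) = {p : ℝ × ℝ | p.1 < h}.indicator fun p => p.2 / p.1 := by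
    ext p
    by_cases hp : p.1 < h <;> simp [f, hp, div_eq_inv_mul]
  have e2 : (fun p => f p * m p.1) = {p : ℝ × ℝ | p.1 < h}.indicator fun p => m p.1 / p.1 := by
    ext p
    by_cases hp : p.1 < h <;> simp [f, hp, div_eq_inv_mul]
  have hi : Integrable (f * fun p => p.2) Q := by
    rw [e1]
    exact hint.indicator (measurableSet_lt measurable_fst measurable_const)
  have hce : Q[f * (fun p => p.2) |
      MeasurableSpace.comap (fun p : ℝ × ℝ => p.1) inferInstance] =ᵐ[Q] fun p => f p * m p.1 := by
    filter_upwards [condExp_mul_of_stronglyMeasurable_left hfm hi hB, hm.2] with p h1 h2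
    rw [h1, Pi.mul_apply, h2]
  rw [← e1, ← e2]
  exact ⟨integrable_condExp.congr hce, by rw [← integral_condExp hFle, integral_congr_ae hce]⟩

/-- The part of `E[B / A]` lost by trimming, after the Taylor correction with the true derivatives, is
`O(h ^ (k - 1) P(A < h))`. -/
lemma exists_abs_trimming_bias_le (hA : ∀ᵐ p ∂Q, 0 ≤ p.1)
    (hint : Integrable (fun p : ℝ × ℝ => p.2 / p.1) Q) {k : ℕ} (hk : 1 ≤ k) {m : ℝ → ℝ}
    (hm : IsCondMean Q m) (hlaw : LawAssumption Q m k) :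
    ∃ b > 0, ∃ C ≥ 0, ∀ h, 0 < h → h ≤ b →
      |∫ p, trimmedRatio h p ∂Q + ∑ κ ∈ Finset.Icc 1 (k - 1), coeff Q h κ * derivOnNonneg m κ 0
        - theta Q| ≤ C * h ^ (k - 1) * Q.real {p | p.1 < h} := by
  obtain ⟨δ, hδ, hsm, -⟩ := hlaw.smooth
  obtain ⟨b, hb, C, hC, hT⟩ := exists_abs_div_sub_taylor_le hk hlaw.zero hδ hsm
  refine ⟨b, hb, C, hC, fun h hh hhb => ?_⟩
  have hBint : Integrable (fun p : ℝ × ℝ => p.2) Q := hlaw.fourth_moment.integrable (by norm_num)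
  have hms : MeasurableSet {p : ℝ × ℝ | p.1 < h} := measurableSet_lt measurable_fst measurable_const
  obtain ⟨hmi, hmeq⟩ := integral_indicator_div_eq hint hBint hm h
  have hsplit : theta Q = ∫ p, trimmedRatio h p ∂Q
      + ∫ p, {p : ℝ × ℝ | p.1 < h}.indicator (fun p => p.2 / p.1) p ∂Q := by
    have hti : Integrable (trimmedRatio h) Q :=
      hint.indicator (measurableSet_le measurable_const measurable_fst)
    rw [theta, ← integral_add hti (hint.indicator hms)]
    refine integral_congr_ae (ae_of_all _ fun p => ?_)
    by_cases hp : p.1 < h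
    · simp [trimmedRatio, hp]
    · simp [trimmedRatio, hp, not_lt.1 hp]
  have hpi κ : Integrable (fun p => trimmedPower h κ p / (κ.factorial : ℝ) * derivOnNonneg m κ 0) Q :=
    (((memLp_trimmedPower hA hh κ 1).integrable le_rfl).div_const _).mul_const _
  have hsum : ∑ κ ∈ Finset.Icc 1 (k - 1), coeff Q h κ * derivOnNonneg m κ 0
      = ∫ p, ∑ κ ∈ Finset.Icc 1 (k - 1),
        trimmedPower h κ p / (κ.factorial : ℝ) * derivOnNonneg m κ 0 ∂Q := by
    rw [integral_finsetSum _ fun κ _ => hpi κ]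
    refine Finset.sum_congr rfl fun κ _ => ?_
    rw [integral_mul_const, integral_div, coeff]
  rw [hsplit, hmeq, add_sub_add_left_eq_sub, abs_sub_comm, hsum,
    ← integral_sub hmi (integrable_finsetSum _ fun κ _ => hpi κ), ← integral_indicator_fst_lt,
    ← Real.norm_eq_abs]
  refine norm_integral_le_of_norm_le (integrable_indicator_fst_lt _ _) ?_
  have hne : ∀ᵐ p ∂Q, p.1 ≠ 0 := by
    rw [ae_iff]; simpa using hlaw.no_mass
  filter_upwards [hA, hne] with p hp hp0
  have hp' : 0 < p.1 := lt_of_le_of_ne hp (Ne.symm hp0)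
  by_cases hlt : p.1 < h
  · simp only [trimmedPower, Set.indicator, Set.mem_ofPred_eq, hlt, if_true, Real.norm_eq_abs]
    refine (hT p.1 hp' (hlt.le.trans hhb)).trans ?_
    gcongr
  · simp [trimmedPower, hlt]

/-- The remaining bias is `o(n ^ (-1/2))`: `√n h ^ (k - 1)` is bounded and `P(A < h) → 0`. -/
lemma tendsto_sqrt_mul_trimming_bias (hA : ∀ᵐ p ∂Q, 0 ≤ p.1)
    (hint : Integrable (fun p : ℝ × ℝ => p.2 / p.1) Q) {k : ℕ} (hk : 1 ≤ k) {m : ℝ → ℝ}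
    (hm : IsCondMean Q m) (hlaw : LawAssumption Q m k) {h : ℕ → ℝ} (hh : ThresholdAssumption h k) :
    Tendsto (fun n : ℕ => √(n : ℝ) * (∫ p, trimmedRatio (h n) p ∂Q
      + ∑ κ ∈ Finset.Icc 1 (k - 1), coeff Q (h n) κ * derivOnNonneg m κ 0 - theta Q))
      atTop (𝓝 0) := by
  obtain ⟨b, hb, C, hC, hbias⟩ := exists_abs_trimming_bias_le hA hint hk hm hlaw
  obtain ⟨D, hD⟩ := hh.upper.bound
  have hP := tendsto_measureReal_fst_lt hA hlaw.no_mass hh.pos hh.tendsto_zero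
  refine squeeze_zero_norm' (a := fun n => C * √D * Q.real {p | p.1 < h n}) ?_
    (by simpa using hP.const_mul (C * √D))
  filter_upwards [hD, hh.tendsto_zero.eventually_le_const hb] with n hn hnb
  have hpos := hh.pos n
  have h1 : √(n : ℝ) * h n ^ (k - 1) ≤ √D := by
    refine Real.le_sqrt_of_sq_le ?_
    rw [mul_pow, Real.sq_sqrt n.cast_nonneg, ← pow_mul, mul_comm (k - 1) 2]
    simpa using (le_abs_self _).trans hn
  rw [norm_mul, Real.norm_of_nonneg (Real.sqrt_nonneg _), Real.norm_eq_abs]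
  calc _ ≤ √(n : ℝ) * (C * h n ^ (k - 1) * Q.real {p | p.1 < h n}) := by
        gcongr; exact hbias _ hpos hnb
    _ = C * (√(n : ℝ) * h n ^ (k - 1)) * Q.real {p | p.1 < h n} := by ring
    _ ≤ _ := by gcongr

end Trimming

section AsymptoticNormality

variable {Q : Measure (ℝ × ℝ)}

/-! ### The leading term -/

lemma measurable_Z (k : ℕ) (h : ℝ) {ψ : ℕ → ℝ × ℝ → ℝ} (hψ : ∀ κ, Measurable (ψ κ)) :
    Measurable (Z Q k h ψ) := by
  unfold Z
  fun_prop

lemma empMean_Z {Ω : Type*} (X : ℕ → Ω → ℝ × ℝ) (k n : ℕ) (h : ℝ) (ψ : ℕ → ℝ × ℝ → ℝ) (ω : Ω) :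
    empMean X n (Z Q k h ψ) ω = empMean X n (trimmedRatio h) ω
      + ∑ κ ∈ Finset.Icc 1 (k - 1), coeff Q h κ * empMean X n (ψ κ) ω := by
  simp only [empMean, Z, Finset.sum_add_distrib, mul_add]
  rw [Finset.sum_comm]
  simp_rw [← Finset.mul_sum]
  refine congrArg _ ?_
  rw [Finset.mul_sum]
  exact Finset.sum_congr rfl fun κ _ => by ring

lemma integral_Z {k : ℕ} {h : ℝ} (hint : Integrable (fun p : ℝ × ℝ => p.2 / p.1) Q)
    {ψ : ℕ → ℝ × ℝ → ℝ}
    (hψ : ∀ κ ∈ Finset.Icc 1 (k - 1), Integrable (ψ κ) Q ∧ ∫ p, ψ κ p ∂Q = 0) :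
    ∫ p, Z Q k h ψ p ∂Q = ∫ p, trimmedRatio h p ∂Q := by
  have hti : Integrable (trimmedRatio h) Q :=
    hint.indicator (measurableSet_le measurable_const measurable_fst)
  have hi : ∀ κ ∈ Finset.Icc 1 (k - 1), Integrable (fun p => coeff Q h κ * ψ κ p) Q :=
    fun κ hκ => (hψ κ hκ).1.const_mul _
  simp only [Z]
  rw [integral_add hti (integrable_finsetSum _ hi), integral_finsetSum _ hi,
    Finset.sum_eq_zero, add_zero]
  intro κ hκ
  rw [integral_const_mul, (hψ κ hκ).2, mul_zero]

lemma eLpNorm_trimmedRatio_le {h : ℝ} (hh : 0 < h) (q : ENNReal) :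
    eLpNorm (trimmedRatio h) q Q ≤ ENNReal.ofReal h⁻¹ * eLpNorm (fun p : ℝ × ℝ => p.2) q Q := by
  refine eLpNorm_le_mul_eLpNorm_of_ae_le_mul (ae_of_all _ fun p => ?_) q
  by_cases hp : h ≤ p.1
  · have hp0 : 0 < p.1 := hh.trans_le hp
    simp only [trimmedRatio, Set.indicator, Set.mem_ofPred_eq, hp, if_true, norm_div,
      Real.norm_of_nonneg hp0.le]
    rw [div_eq_inv_mul]
    gcongr
  · simp only [trimmedRatio, Set.indicator, Set.mem_ofPred_eq, hp, if_false, norm_zero]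
    positivity

variable [IsProbabilityMeasure Q]

lemma abs_coeff_mul_inv_pow_le (hA : ∀ᵐ p ∂Q, 0 ≤ p.1) {h : ℝ} (hh : 0 < h) (κ : ℕ) :
    |coeff Q h κ * (h ^ (κ - 1))⁻¹| ≤ Q.real {p | p.1 < h} := by
  have hpow : 0 < h ^ (κ - 1) := by positivity
  rw [abs_mul, abs_inv, abs_of_pos hpow, ← div_eq_mul_inv, div_le_iff₀' hpow]
  exact abs_coeff_le hA h κ

lemma eLpNorm_coeff_mul_le (hA : ∀ᵐ p ∂Q, 0 ≤ p.1) {h : ℝ} (hh : 0 < h) (κ : ℕ)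
    (f : ℝ × ℝ → ℝ) {b : ℝ} {q : ENNReal}
    (hf : eLpNorm (fun p => h ^ (κ - 1) * f p) q Q ≤ ENNReal.ofReal b) :
    eLpNorm (fun p => coeff Q h κ * f p) q Q
      ≤ ENNReal.ofReal (Q.real {p | p.1 < h} * b) := by
  have hpow : 0 < h ^ (κ - 1) := by positivity
  rw [ENNReal.ofReal_mul measureReal_nonneg]
  refine (eLpNorm_le_mul_eLpNorm_of_ae_le_mul (g := fun p => h ^ (κ - 1) * f p)
    (ae_of_all _ fun p => ?_) q).trans (by gcongr)
  rw [norm_mul, norm_mul, Real.norm_of_nonneg hpow.le, ← mul_assoc, mul_comm (Q.real _)]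
  gcongr
  exact abs_coeff_le hA h κ

lemma tendsto_inv_mul_rpow_inv {h : ℕ → ℝ} {k : ℕ} (hh : ThresholdAssumption h k) :
    Tendsto (fun n : ℕ => (h n)⁻¹ * ((n : ℝ) ^ (1 / 4 : ℝ))⁻¹) atTop (𝓝 0) := by
  have := hh.lower.rpow_const (p := (1 / 4 : ℝ)) (Or.inr (by norm_num))
  rw [Real.zero_rpow (by norm_num)] at this
  refine this.congr fun n => ?_
  have hp := hh.pos n
  rw [Real.mul_rpow (by positivity) (by positivity), Real.inv_rpow (by positivity),
    Real.inv_rpow (by positivity), ← Real.rpow_natCast, ← Real.rpow_mul hp.le, mul_comm]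
  norm_num

lemma rpow_fourth_pow (n : ℕ) : ((n : ℝ) ^ (1 / 4 : ℝ)) ^ 4 = n := by
  rw [← Real.rpow_natCast, ← Real.rpow_mul n.cast_nonneg]
  norm_num

/-- The `L⁴` norm of `Z_h` is `o(n ^ (1/4))`: trimming bounds that of `(B / A) · 1{A ≥ h}` by
`h⁻¹ ‖B‖₄`, and `c_h` is small enough to make the influence functions negligible. -/
lemma exists_eLpNorm_Z_le (hA : ∀ᵐ p ∂Q, 0 ≤ p.1) {k : ℕ} {m : ℝ → ℝ}
    (hlaw : LawAssumption Q m k) {h : ℕ → ℝ} (hh : ThresholdAssumption h k)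
    {ψ : ℕ → ℕ → ℝ × ℝ → ℝ} (hψmeas : ∀ n κ, Measurable (ψ n κ))
    (hψ : ∀ κ ∈ Finset.Icc 1 (k - 1), ∃ C : ℝ, ∀ᶠ n : ℕ in atTop,
      eLpNorm (fun p => h n ^ (κ - 1) * ψ n κ p) 4 Q
        ≤ ENNReal.ofReal (C * (n : ℝ) ^ (1 / 4 : ℝ))) :
    ∃ r : ℕ → ℝ, (∀ n, 0 ≤ r n) ∧ Tendsto r atTop (𝓝 0) ∧ ∀ᶠ n : ℕ in atTop,
      eLpNorm (Z Q k (h n) (ψ n)) 4 Q ≤ ENNReal.ofReal (r n * (n : ℝ) ^ (1 / 4 : ℝ)) := by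
  choose! C hC using hψ
  set b := (eLpNorm (fun p : ℝ × ℝ => p.2) 4 Q).toReal with hb
  set P : ℕ → ℝ := fun n => Q.real {p | p.1 < h n} with hP
  have hP0 n : 0 ≤ P n := measureReal_nonneg
  have hPlim : Tendsto P atTop (𝓝 0) :=
    tendsto_measureReal_fst_lt hA hlaw.no_mass hh.pos hh.tendsto_zero
  refine ⟨fun n => (h n)⁻¹ * ((n : ℝ) ^ (1 / 4 : ℝ))⁻¹ * b
    + ∑ κ ∈ Finset.Icc 1 (k - 1), P n * |C κ|, fun n => ?_, ?_, ?_⟩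
  · have := hh.pos n
    have := Finset.sum_nonneg fun κ (_ : κ ∈ Finset.Icc 1 (k - 1)) =>
      mul_nonneg (hP0 n) (abs_nonneg (C κ))
    positivity
  · simpa using ((tendsto_inv_mul_rpow_inv hh).mul_const b).add
      (tendsto_finsetSum (Finset.Icc 1 (k - 1)) fun κ _ => hPlim.mul_const |C κ|)
  · filter_upwards [(Finset.eventually_all _).2 hC, eventually_ge_atTop 1] with n hn hn1
    have hn' : (0 : ℝ) < n := by exact_mod_cast hn1
    have hq : 0 < (n : ℝ) ^ (1 / 4 : ℝ) := by positivity
    have hpos := hh.pos n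
    set q := (n : ℝ) ^ (1 / 4 : ℝ)
    have h1 : eLpNorm (trimmedRatio (h n)) 4 Q ≤ ENNReal.ofReal ((h n)⁻¹ * b) := by
      rw [ENNReal.ofReal_mul (by positivity), hb,
        ENNReal.ofReal_toReal hlaw.fourth_moment.eLpNorm_ne_top]
      exact eLpNorm_trimmedRatio_le hpos 4
    have h2 : ∀ κ ∈ Finset.Icc 1 (k - 1), eLpNorm (fun p => coeff Q (h n) κ * ψ n κ p) 4 Q
        ≤ ENNReal.ofReal (P n * (|C κ| * q)) := fun κ hκ =>
      eLpNorm_coeff_mul_le hA hpos κ _ ((hn κ hκ).trans (by gcongr; exact le_abs_self _))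
    have hZ : Z Q k (h n) (ψ n) = trimmedRatio (h n)
        + ∑ κ ∈ Finset.Icc 1 (k - 1), fun p => coeff Q (h n) κ * ψ n κ p := by
      ext p; simp [Z]
    have hm κ : Measurable fun p => coeff Q (h n) κ * ψ n κ p := (hψmeas n κ).const_mul _
    have h14 : (1 : ENNReal) ≤ 4 := by norm_num
    rw [hZ]
    calc _ ≤ ENNReal.ofReal ((h n)⁻¹ * b)
          + ∑ κ ∈ Finset.Icc 1 (k - 1), ENNReal.ofReal (P n * (|C κ| * q)) := by
          refine (eLpNorm_add_le (measurable_trimmedRatio _).aestronglyMeasurable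
            (Finset.aestronglyMeasurable_sum _ fun κ _ => (hm κ).aestronglyMeasurable)
            h14).trans (add_le_add h1 ?_)
          exact (eLpNorm_sum_le (fun κ _ => (hm κ).aestronglyMeasurable) h14).trans
            (Finset.sum_le_sum h2)
      _ = ENNReal.ofReal ((h n)⁻¹ * b + ∑ κ ∈ Finset.Icc 1 (k - 1), P n * (|C κ| * q)) := by
          have h0 : ∀ κ ∈ Finset.Icc 1 (k - 1), 0 ≤ P n * (|C κ| * q) := fun κ _ =>
            mul_nonneg (hP0 n) (by positivity)
          rw [← ENNReal.ofReal_sum_of_nonneg h0,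
            ← ENNReal.ofReal_add (by positivity) (Finset.sum_nonneg h0)]
      _ = _ := by
          congr 1
          rw [add_mul, Finset.sum_mul]
          congr 1
          · field_simp
          · exact Finset.sum_congr rfl fun κ _ => by ring

/-- The Lyapunov condition for `Z_h`. -/
lemma tendsto_integral_Z_sub_pow_div (hA : ∀ᵐ p ∂Q, 0 ≤ p.1) {k : ℕ} {m : ℝ → ℝ}
    (hlaw : LawAssumption Q m k) {h : ℕ → ℝ} (hh : ThresholdAssumption h k)
    {ψ : ℕ → ℕ → ℝ × ℝ → ℝ} (hψmeas : ∀ n κ, Measurable (ψ n κ))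
    (hψ : ∀ κ ∈ Finset.Icc 1 (k - 1), ∃ C : ℝ, ∀ᶠ n : ℕ in atTop,
      eLpNorm (fun p => h n ^ (κ - 1) * ψ n κ p) 4 Q
        ≤ ENNReal.ofReal (C * (n : ℝ) ^ (1 / 4 : ℝ))) :
    (∀ᶠ n in atTop, MemLp (Z Q k (h n) (ψ n)) 4 Q) ∧
    Tendsto (fun n : ℕ => (∫ p, (Z Q k (h n) (ψ n) p - ∫ q, Z Q k (h n) (ψ n) q ∂Q) ^ 4 ∂Q) / n)
      atTop (𝓝 0) := by
  obtain ⟨r, hr0, hr, hrZ⟩ := exists_eLpNorm_Z_le hA hlaw hh hψmeas hψ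
  have hZm n := (measurable_Z (Q := Q) k (h n) (hψmeas n)).aestronglyMeasurable (μ := Q)
  refine ⟨hrZ.mono fun n hn => ⟨hZm n, hn.trans_lt ENNReal.ofReal_lt_top⟩, ?_⟩
  refine squeeze_zero' (g := fun n => (2 * r n) ^ 4) (.of_forall fun n => by positivity) ?_
    (by simpa using (hr.const_mul 2).pow 4)
  filter_upwards [hrZ, eventually_ge_atTop 1] with n hn hn1
  have hn' : (0 : ℝ) < n := by exact_mod_cast hn1
  have hr0' := hr0 n
  have hle := integral_abs_pow_le_of_eLpNorm_le (p := 4) (b := 2 * (r n * (n : ℝ) ^ (1 / 4 : ℝ)))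
    ((hZm n).sub aestronglyMeasurable_const) four_ne_zero (by positivity)
    (f := fun p => Z Q k (h n) (ψ n) p - ∫ q, Z Q k (h n) (ψ n) q ∂Q) (by
      refine (eLpNorm_sub_integral_le (hZm n) (by norm_num)).trans ?_
      rw [ENNReal.ofReal_mul (by norm_num), ENNReal.ofReal_ofNat]
      gcongr
      simpa using hn)
  simp only [Even.pow_abs (show Even 4 by decide)] at hle
  rw [div_le_iff₀ hn']
  refine hle.trans (le_of_eq ?_)
  rw [← mul_assoc, mul_pow _ ((n : ℝ) ^ (1 / 4 : ℝ)), rpow_fourth_pow]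

/-! ### Asymptotic linearity of the bias-corrected estimator -/

variable {Ω : Type*} [MeasurableSpace Ω] {μ : Measure Ω} [IsProbabilityMeasure μ]
  {X : ℕ → Ω → ℝ × ℝ}

/-- The empirical counterpart of `coeff Q h κ` is `o_p(h ^ (κ - 1) n ^ (-1/2))` away from it, because
`1{A < h}` has vanishing second moment. -/
lemma tendstoInMeasure_empMean_trimmedPower (hA : ∀ᵐ p ∂Q, 0 ≤ p.1) (h0 : Q {p | p.1 = 0} = 0)
    (hXlaw : ∀ i, HasLaw (X i) Q μ) (hXindep : iIndepFun X μ) {h : ℕ → ℝ} (hpos : ∀ n, 0 < h n)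
    (hlim : Tendsto h atTop (𝓝 0)) (κ : ℕ) :
    TendstoInMeasure μ (fun (n : ℕ) ω => √(n : ℝ) * (h n ^ (κ - 1))⁻¹ *
      (empMean X n (trimmedPower (h n) κ) ω / (κ.factorial : ℝ) - coeff Q (h n) κ)) atTop
      (fun _ => (0 : ℝ)) := by
  set a : ℕ → ℝ := fun n => (h n ^ (κ - 1))⁻¹ / κ.factorial with ha
  have hPlim := tendsto_measureReal_fst_lt hA h0 hpos hlim
  have ha0 n : 0 ≤ a n := by have := hpos n; positivity
  have hf : (1 : ℝ) ≤ κ.factorial := by exact_mod_cast κ.factorial_pos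
  have key := tendstoInMeasure_sqrt_mul_sub_integral hXlaw hXindep
    (f := fun n p => a n * trimmedPower (h n) κ p)
    (.of_forall fun n => (memLp_trimmedPower hA (hpos n) κ 2).const_mul _) ?_
  · refine key.congr_left fun n => ae_of_all _ fun ω => ?_
    simp only [ha, empMean, coeff]
    rw [integral_const_mul, ← Finset.mul_sum]
    ring
  · refine squeeze_zero (fun n => by positivity) (fun n => ?_) hPlim
    have hp := hpos n
    simp_rw [mul_pow]
    rw [integral_const_mul]
    calc _ ≤ a n ^ 2 * ((h n ^ (κ - 1)) ^ 2 * Q.real {p | p.1 < h n}) := by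
          gcongr; exact integral_trimmedPower_pow_le hA (h n) κ two_ne_zero
      _ = ((κ.factorial : ℝ)⁻¹) ^ 2 * Q.real {p | p.1 < h n} := by
          simp only [ha]; field_simp
      _ ≤ _ := mul_le_of_le_one_left measureReal_nonneg
          (pow_le_one₀ (by positivity) (inv_le_one_of_one_le₀ hf))

/-- The rescaled empirical means of the influence functions tend to zero in probability: their
second moments are `O(n ^ (1/2))` by the fourth-moment bound. -/
lemma tendstoInMeasure_pow_mul_empMean_influence (hXlaw : ∀ i, HasLaw (X i) Q μ)
    (hXindep : iIndepFun X μ) {h : ℕ → ℝ} {κ : ℕ} {ψ : ℕ → ℝ × ℝ → ℝ}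
    (hψmeas : ∀ n, Measurable (ψ n)) (hcent : ∀ n, ∫ p, ψ n p ∂Q = 0) {C : ℝ}
    (hmom : ∀ᶠ n : ℕ in atTop, eLpNorm (fun p => h n ^ (κ - 1) * ψ n p) 4 Q
        ≤ ENNReal.ofReal (C * (n : ℝ) ^ (1 / 4 : ℝ))) :
    TendstoInMeasure μ (fun (n : ℕ) ω => h n ^ (κ - 1) * empMean X n (ψ n) ω) atTop
      (fun _ => (0 : ℝ)) := by
  have hm n : AEStronglyMeasurable (fun p => h n ^ (κ - 1) * ψ n p) Q :=
    ((hψmeas n).const_mul _).aestronglyMeasurable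
  have h2 : ∀ᶠ n : ℕ in atTop, eLpNorm (fun p => h n ^ (κ - 1) * ψ n p) (2 : ℕ) Q
      ≤ ENNReal.ofReal (|C| * (n : ℝ) ^ (1 / 4 : ℝ)) := by
    filter_upwards [hmom] with n hn
    exact (eLpNorm_le_eLpNorm_of_exponent_le (by norm_num) (hm n)).trans
      (hn.trans (by gcongr; exact le_abs_self C))
  have key := tendstoInMeasure_sqrt_mul_sub_integral hXlaw hXindep
    -- the factor `n ^ (-1/2)` absorbs the `√n` of the general statement
    (f := fun n p => (√(n : ℝ))⁻¹ * (h n ^ (κ - 1) * ψ n p)) ?_ ?_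
  · refine TendstoInMeasure.congr' ?_ ae_eq_rfl key
    filter_upwards [eventually_ge_atTop 1] with n hn1
    have hn' : √(n : ℝ) ≠ 0 := (Real.sqrt_pos.2 (by exact_mod_cast hn1)).ne'
    refine ae_of_all _ fun ω => ?_
    simp only [empMean]
    rw [integral_const_mul, integral_const_mul, hcent, ← Finset.mul_sum, ← Finset.mul_sum]
    field_simp
    ring
  · filter_upwards [h2] with n hn
    exact MemLp.const_mul ⟨hm n, by simpa using hn.trans_lt ENNReal.ofReal_lt_top⟩ _
  · refine squeeze_zero' (g := fun n : ℕ => C ^ 2 * (√(n : ℝ))⁻¹)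
      (.of_forall fun n => by positivity) ?_ ?_
    · filter_upwards [h2] with n hn
      have hle := integral_abs_pow_le_of_eLpNorm_le (hm n) two_ne_zero (by positivity) hn
      simp only [sq_abs] at hle
      simp_rw [mul_pow (√(n : ℝ))⁻¹]
      rw [integral_const_mul]
      have hq : ((n : ℝ) ^ (1 / 4 : ℝ)) ^ 2 = √(n : ℝ) := by
        rw [Real.sqrt_eq_rpow, ← Real.rpow_natCast, ← Real.rpow_mul n.cast_nonneg]
        norm_num
      calc _ ≤ (√(n : ℝ))⁻¹ ^ 2 * (|C| * (n : ℝ) ^ (1 / 4 : ℝ)) ^ 2 := by gcongr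
        _ = C ^ 2 * ((√(n : ℝ))⁻¹ * √(n : ℝ) * (√(n : ℝ))⁻¹) := by
          rw [mul_pow |C|, sq_abs, hq]; ring
        _ = _ := by
          rcases eq_or_ne (√(n : ℝ)) 0 with e | e
          · simp [e]
          · rw [inv_mul_cancel₀ e, one_mul]
    · have : Tendsto (fun n : ℕ => (√(n : ℝ))⁻¹) atTop (𝓝 0) :=
        tendsto_inv_atTop_zero.comp (Real.tendsto_sqrt_atTop.comp tendsto_natCast_atTop_atTop)
      simpa using this.const_mul (C ^ 2)

/-- Each summand of the bias estimator is linearized through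
`ĉ m̂ - c m = c (m̂ - m) + (ĉ - c) m + (ĉ - c) (m̂ - m)`. -/
lemma tendstoInMeasure_bias_summand (hA : ∀ᵐ p ∂Q, 0 ≤ p.1)
    (hXlaw : ∀ i, HasLaw (X i) Q μ) (hXindep : iIndepFun X μ) {k : ℕ} {m : ℝ → ℝ}
    (hlaw : LawAssumption Q m k) {h : ℕ → ℝ} (hh : ThresholdAssumption h k)
    {mhat : ℕ → ℕ → Ω → ℝ} {ψ : ℕ → ℕ → ℝ × ℝ → ℝ} (hψmeas : ∀ n κ, Measurable (ψ n κ))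
    (hψ : InfluenceAssumption μ Q X m k h mhat ψ) {κ : ℕ} (hκ : κ ∈ Finset.Icc 1 (k - 1)) :
    TendstoInMeasure μ (fun (n : ℕ) ω => √(n : ℝ) *
      (empMean X n (trimmedPower (h n) κ) ω / (κ.factorial : ℝ) * mhat n κ ω
        - coeff Q (h n) κ * derivOnNonneg m κ 0 - coeff Q (h n) κ * empMean X n (ψ n κ) ω)) atTop
      (fun _ => (0 : ℝ)) := by
  obtain ⟨C, hC⟩ := hψ.moment κ hκ
  set d := derivOnNonneg m κ 0
  have hlin := hψ.linear κ hκ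
  have hc := tendstoInMeasure_empMean_trimmedPower hA hlaw.no_mass hXlaw hXindep hh.pos
    hh.tendsto_zero κ
  have hm := tendstoInMeasure_pow_mul_empMean_influence hXlaw hXindep (fun n => hψmeas n κ)
    (fun n => (hψ.centered n κ hκ).2) hC
  have hinv : ∀ᶠ n : ℕ in atTop, |(√(n : ℝ))⁻¹| ≤ 1 := by
    filter_upwards [eventually_ge_atTop 1] with n hn
    rw [abs_of_nonneg (by positivity)]
    exact inv_le_one_of_one_le₀ (Real.one_le_sqrt.2 (by exact_mod_cast hn))
  have hcb : ∀ᶠ n in atTop, |coeff Q (h n) κ * (h n ^ (κ - 1))⁻¹| ≤ 1 := .of_forall fun n =>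
    (abs_coeff_mul_inv_pow_le hA (hh.pos n) κ).trans measureReal_le_one
  have hdb : ∀ᶠ n in atTop, |h n ^ (κ - 1) * d| ≤ |d| := by
    filter_upwards [hh.tendsto_zero.eventually_le_const one_pos] with n hn
    have := hh.pos n
    rw [abs_mul, abs_of_nonneg (by positivity)]
    exact mul_le_of_le_one_left (abs_nonneg d) (pow_le_one₀ this.le hn)
  refine TendstoInMeasure.congr' ?_ ae_eq_rfl (((hlin.const_mul_of_zero hcb).add_of_zero
    (hc.const_mul_of_zero hdb)).add_of_zero
      (hc.mul_of_zero ((hlin.const_mul_of_zero hinv).add_of_zero hm)))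
  filter_upwards [eventually_ge_atTop 1] with n hn
  have hn' : √(n : ℝ) ≠ 0 := (Real.sqrt_pos.2 (by exact_mod_cast hn)).ne'
  have hp := hh.pos n
  refine ae_of_all _ fun ω => ?_
  field_simp
  ring

/-- The bias-corrected estimator is asymptotically linear with influence function
`Z_h - E[Z_h]`. -/
lemma tendstoInMeasure_estimator_sub_empMean_Z (hA : ∀ᵐ p ∂Q, 0 ≤ p.1)
    (hint : Integrable (fun p : ℝ × ℝ => p.2 / p.1) Q)
    (hXlaw : ∀ i, HasLaw (X i) Q μ) (hXindep : iIndepFun X μ) {k : ℕ} (hk : 1 ≤ k) {m : ℝ → ℝ}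
    (hm : IsCondMean Q m) (hlaw : LawAssumption Q m k) {h : ℕ → ℝ} (hh : ThresholdAssumption h k)
    {mhat : ℕ → ℕ → Ω → ℝ} {ψ : ℕ → ℕ → ℝ × ℝ → ℝ} (hψmeas : ∀ n κ, Measurable (ψ n κ))
    (hψ : InfluenceAssumption μ Q X m k h mhat ψ) :
    TendstoInMeasure μ (fun (n : ℕ) ω => √(n : ℝ) *
      (trimmedEstimator X n (h n) ω - biasEstimator X n k (h n) (mhat n) ω - theta Q
        - (empMean X n (Z Q k (h n) (ψ n)) ω - ∫ p, Z Q k (h n) (ψ n) p ∂Q))) atTop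
      (fun _ => (0 : ℝ)) := by
  have h1 := TendstoInMeasure.sum_of_zero (Finset.Icc 1 (k - 1)) fun κ hκ =>
    tendstoInMeasure_bias_summand hA hXlaw hXindep hlaw hh hψmeas hψ hκ
  have h2 := tendstoInMeasure_of_tendsto_const (μ := μ)
    (tendsto_sqrt_mul_trimming_bias hA hint hk hm hlaw hh)
  refine (h1.add_of_zero h2).congr_left fun n => ae_of_all _ fun ω => ?_
  simp only [trimmedEstimator, biasEstimator]
  rw [empMean_Z, integral_Z hint (hψ.centered n), ← Finset.mul_sum, Finset.sum_sub_distrib,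
    Finset.sum_sub_distrib]
  ring

end AsymptoticNormality

end TrimmedRatio

theorem theorem1
    {Ω : Type*} [MeasurableSpace Ω] (μ : Measure Ω) [IsProbabilityMeasure μ]
    -- the joint law of `(A, B)`, with `A ≥ 0` and with `E[B / A]` well defined
    (Q : Measure (ℝ × ℝ)) [IsProbabilityMeasure Q]
    (hA : ∀ᵐ p ∂Q, 0 ≤ p.1)
    (hint : Integrable (fun p : ℝ × ℝ => p.2 / p.1) Q)
    -- the observations: independent copies of `(A, B)`
    (X : ℕ → Ω → ℝ × ℝ) (hXmeas : ∀ i, Measurable (X i))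
    (hXlaw : ∀ i, HasLaw (X i) Q μ) (hXindep : iIndepFun X μ)
    -- the conditional expectation function and its order of smoothness
    (k : ℕ) (hk : 1 ≤ k) (m : ℝ → ℝ) (hm : TrimmedRatio.IsCondMean Q m)
    (hlaw : TrimmedRatio.LawAssumption Q m k)
    -- the trimming thresholds
    (h : ℕ → ℝ) (hh : TrimmedRatio.ThresholdAssumption h k)
    -- the derivative estimators and their influence functions
    (mhat : ℕ → ℕ → Ω → ℝ) (hmhat : ∀ n κ, Measurable (mhat n κ))
    (ψ : ℕ → ℕ → ℝ × ℝ → ℝ) (hψmeas : ∀ n κ, Measurable (ψ n κ))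
    (hψ : TrimmedRatio.InfluenceAssumption μ Q X m k h mhat ψ)
    -- `Var(Z_h)` is bounded away from zero
    (hvar : ∃ c > 0, ∀ᶠ n : ℕ in atTop, c ≤ Var[TrimmedRatio.Z Q k (h n) (ψ n); Q]) :
    TendstoInDistribution
      (fun (n : ℕ) ω =>
        (TrimmedRatio.trimmedEstimator X n (h n) ω
            - TrimmedRatio.biasEstimator X n k (h n) (mhat n) ω - TrimmedRatio.theta Q)
          / √(Var[TrimmedRatio.Z Q k (h n) (ψ n); Q] / (n : ℝ)))
      atTop (id : ℝ → ℝ) (fun _ => μ) (gaussianReal 0 1) := by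
  obtain ⟨c, hc, hvar⟩ := hvar
  obtain ⟨h4, hlyap⟩ := TrimmedRatio.tendsto_integral_Z_sub_pow_div hA hlaw hh hψmeas hψ.moment
  have hclt := TrimmedRatio.tendstoInDistribution_sum_sub_div_sqrt_variance hXlaw hXindep
    (fun n => TrimmedRatio.measurable_Z k (h n) (hψmeas n)) h4 hc hvar hlyap
  refine tendstoInDistribution_of_tendstoInMeasure_sub _ _ hclt ?_ fun n => ?_
  · have hinv : ∀ᶠ n in atTop, |(√Var[TrimmedRatio.Z Q k (h n) (ψ n); Q])⁻¹| ≤ (√c)⁻¹ := by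
      filter_upwards [hvar] with n hn
      rw [abs_of_nonneg (by positivity)]
      gcongr
    refine TendstoInMeasure.congr' ?_ ae_eq_rfl
      ((TrimmedRatio.tendstoInMeasure_estimator_sub_empMean_Z hA hint hXlaw hXindep hk hm
        hlaw hh hψmeas hψ).const_mul_of_zero hinv)
    filter_upwards [eventually_ge_atTop 1] with n hn
    have hn' : (0 : ℝ) < n := by exact_mod_cast hn
    refine ae_of_all _ fun ω => ?_
    simp only [Pi.sub_apply, TrimmedRatio.empMean]
    rw [Real.sqrt_div (variance_nonneg _ _), ← Finset.sum_div, Finset.sum_sub_distrib,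
      Finset.sum_const, Finset.card_range, nsmul_eq_mul, div_div_eq_mul_div]
    have hs : (n : ℝ)⁻¹ = (√(n : ℝ))⁻¹ * (√(n : ℝ))⁻¹ := by
      rw [← mul_inv, Real.mul_self_sqrt hn'.le]
    have hs' : √(n : ℝ) ≠ 0 := (Real.sqrt_pos.2 hn').ne'
    have hs2 : (n : ℝ) = √(n : ℝ) * √(n : ℝ) := (Real.mul_self_sqrt hn'.le).symm
    set s := √(n : ℝ)
    rw [hs2]
    field_simp
  · refine Measurable.aemeasurable ?_
    have h1 (f : ℝ × ℝ → ℝ) (hf : Measurable f) : Measurable (TrimmedRatio.empMean X n f) := by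
      unfold TrimmedRatio.empMean
      fun_prop
    have h2 := h1 _ (TrimmedRatio.measurable_trimmedRatio (h n))
    have h3 κ := h1 _ (TrimmedRatio.measurable_trimmedPower (h n) κ)
    unfold TrimmedRatio.trimmedEstimator TrimmedRatio.biasEstimator
    fun_prop
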